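/- Let $n\in\mathbb N$, $\alpha\in(0,1)$ and $T>0$; let $\mathbb R^n$ carry the Euclidean scalar product $\langle\cdot,\cdot\rangle$ and norm $\|\cdot\|$. For $k \in \mathbb N$ and a measurable essentially bounded $\varphi:[0,T]\to\mathbb R^k$, let $$(I^\alpha\varphi)(t)=\frac1{\Gamma(\alpha)}\int_0^t\frac{\varphi(\tau)}{(t-\tau)^{1-\alpha}}\,d\tau,\qquad t\in[0,T],$$ be its Riemann–Liouville fractional integral of order $\alpha$, and let $I^\alpha(L^\infty([0,T],\mathbb R^k))$ be the set of functions $x:[0,T]\to\mathbb R^k$ such that, for some such $\varphi$, $x(t)=(I^\alpha\varphi)(t)$ for every $t\in[0,T]$. For $x:[0,T]\to\mathbb R^k$ let $$(D^\alpha x)(t)=\frac1{\Gamma(1-\alpha)}\,\frac{d}{dt}\int_0^t\frac{x(\tau)}{(t-\tau)^{\alpha}}\,d\tau$$ be its Riemann–Liouville fractional derivative of order $\alpha$, at those $t\in[0,T]$ at which it is well defined. Let $x\in I^\alpha(L^\infty([0,T],\mathbb R^n))$ and $y(t)=\|x(t)\|^2$, $t\in[0,T]$. Then $y\in I^\alpha(L^\infty([0,T],\mathbb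 R))$, and for almost every $t\in[0,T]$ the derivatives $(D^\alpha x)(t)$ and $(D^\alpha y)(t)$ are well defined and $$(D^\alpha y)(t)\le 2\langle x(t),(D^\alpha x)(t)\rangle.$$ -/

import Mathlib

open Set MeasureTheory

noncomputable section

namespace FractionalCalculus

variable {E : Type*} [NormedAddCommGroup E] [NormedSpace ℝ E]

/-- The left-sided Riemann-Liouville fractional integral of order `α ∈ (0, 1)` based at `0`:
`(I^α φ)(t) = 1 / Γ(α) * ∫_0^t φ(τ) / (t - τ)^(1 - α) dτ`.
For `t ∈ [0, T]` only the values of `φ` on `[0, T]` matter. -/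
def rlIntegral (α : ℝ) (φ : ℝ → E) (t : ℝ) : E :=
  (1 / Real.Gamma α) • ∫ τ in (0 : ℝ)..t, (1 / (t - τ) ^ (1 - α)) • φ τ

/-- The function under the derivative in the Riemann-Liouville derivative of order `α`,
`s ↦ ∫_0^s x(τ) / (s - τ)^α dτ`. -/
def rlKernelIntegral (α : ℝ) (x : ℝ → E) (s : ℝ) : E :=
  ∫ τ in (0 : ℝ)..s, (1 / (s - τ) ^ α) • x τ

/-- The Riemann-Liouville derivative of order `α` of `x : [0, T] → E` is well defined at `t`:
the integrals `∫_0^s x(τ) / (s - τ)^α dτ`, `s ∈ [0, T]`, exist, and they are differentiable at `t`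
as a function of `s ∈ [0, T]` (one-sidedly if `t` is an end point). -/
def HasRLDerivative (α T : ℝ) (x : ℝ → E) (t : ℝ) : Prop :=
  (∀ s ∈ Icc 0 T, IntervalIntegrable (fun τ => (1 / (s - τ) ^ α) • x τ) volume 0 s) ∧
    DifferentiableWithinAt ℝ (rlKernelIntegral α x) (Icc 0 T) t

/-- The left-sided Riemann-Liouville fractional derivative of order `α ∈ (0, 1)` of a function
`x : [0, T] → E`: `(D^α x)(t) = 1 / Γ(1 - α) * d/dt ∫_0^t x(τ) / (t - τ)^α dτ`.
It is meaningful where `HasRLDerivative α T x t` holds. -/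
def rlDerivative (α T : ℝ) (x : ℝ → E) (t : ℝ) : E :=
  (1 / Real.Gamma (1 - α)) • derivWithin (rlKernelIntegral α x) (Icc 0 T) t

/-- The class `I^α(L^∞([0, T], E))`: functions `x` on `[0, T]` such that `x(t) = (I^α φ)(t)` for
every `t ∈ [0, T]`, for some measurable essentially bounded `φ` on `[0, T]`. -/
def MemRLIntegralLinfty (α T : ℝ) (x : ℝ → E) : Prop :=
  ∃ φ : ℝ → E, MemLp φ ⊤ (volume.restrict (Icc 0 T)) ∧ ∀ t ∈ Icc 0 T, x t = rlIntegral α φ t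

end FractionalCalculus

end

/-!
Write `‖x τ‖² = -‖x t‖² + 2⟪x t, x τ⟫ + ‖x τ - x t‖²`. Let `x = I^α φ`. By the semigroup law
`I^(1-α) x` is the primitive of `φ`, hence Lipschitz, and `x` is `α`-Hölder, so the last term
vanishes to order `2α > α` at `τ = t` and its kernel integral changes by `O(t - s)` between `s`
and `t`. Together with `x 0 = 0`, which controls the constant term, this makes `I^(1-α) ‖x‖²`
Lipschitz. Being injective on continuous functions, `I^(1-α)` then yields `‖x‖² = I^α ψ` with `ψ`
the bounded derivative of `I^(1-α) ‖x‖²`.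

For the inequality, compare increments from `s < t` up to `t`. The constant term contributes
`-‖x t‖² (t^(1-α) - s^(1-α)) / (1-α) ≤ 0`. The last term contributes at most an integral over
`[s, t]`, of size `O((t - s)^(1+α)) = o(t - s)`, because on `[0, s]` the kernel decreases as the
end point moves from `s` to `t`. Dividing by `t - s` and letting `s → t` leaves only the inner
product.
-/

namespace FractionalCalculus

open scoped NNReal

section Kernel

variable {a b c s t τ u : ℝ}

lemma intervalIntegrable_rlKernel (hc : c < 1) (hat : a ≤ t) (hbt : b ≤ t) :
    IntervalIntegrable (fun τ => 1 / (t - τ) ^ c) volume a b := by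
  have hrpow := (intervalIntegral.intervalIntegrable_rpow' (r := -c) (a := t - a) (b := t - b)
    (by linarith)).comp_sub_left t
  simp only [sub_sub_cancel] at hrpow
  refine hrpow.congr fun τ hτ => ?_
  have hτt : τ ≤ t := hτ.2.trans (max_le hat hbt)
  simp [Real.rpow_neg (sub_nonneg.2 hτt)]

lemma integral_rlKernel (hc : c < 1) (hat : a ≤ t) (hbt : b ≤ t) :
    ∫ τ in a..b, 1 / (t - τ) ^ c = ((t - a) ^ (1 - c) - (t - b) ^ (1 - c)) / (1 - c) := by
  have hrpow : ∫ τ in a..b, 1 / (t - τ) ^ c = ∫ τ in a..b, (fun v => v ^ (-c)) (t - τ) := by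
    refine intervalIntegral.integral_congr fun τ hτ => ?_
    have hτt : τ ≤ t := hτ.2.trans (max_le hat hbt)
    simp [Real.rpow_neg (sub_nonneg.2 hτt)]
  rw [hrpow, intervalIntegral.integral_comp_sub_left (fun v => v ^ (-c)) t,
    integral_rpow (Or.inl (by linarith)), neg_add_eq_sub]

lemma integral_rlKernel_self (hc : c < 1) (hat : a ≤ t) :
    ∫ τ in a..t, 1 / (t - τ) ^ c = (t - a) ^ (1 - c) / (1 - c) := by
  rw [integral_rlKernel hc hat le_rfl, sub_self, Real.zero_rpow (by linarith), sub_zero]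

lemma rlKernel_le_rlKernel (hc : 0 ≤ c) (hτs : τ < s) (hst : s ≤ t) :
    1 / (t - τ) ^ c ≤ 1 / (s - τ) ^ c := by
  have : 0 < s - τ := sub_pos.2 hτs
  gcongr

lemma rlKernel_sub_rlKernel_le (hc : c ≤ 1) (hτs : τ < s) (hst : s ≤ t) :
    1 / (s - τ) ^ c - 1 / (t - τ) ^ c ≤ 1 / (s - τ) ^ c * ((t - s) / (t - τ)) := by
  have hs : 0 < s - τ := sub_pos.2 hτs
  have ht : 0 < t - τ := by linarith
  have hratio : (s - τ) / (t - τ) ≤ (s - τ) ^ c / (t - τ) ^ c := by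
    rw [← Real.div_rpow hs.le ht.le]
    simpa using Real.rpow_le_rpow_of_exponent_ge (div_pos hs ht)
      ((div_le_one ht).2 (by linarith)) hc
  calc 1 / (s - τ) ^ c - 1 / (t - τ) ^ c
      = 1 / (s - τ) ^ c * (1 - (s - τ) ^ c / (t - τ) ^ c) := by
        have := (Real.rpow_pos_of_pos hs c).ne'
        field_simp
    _ ≤ 1 / (s - τ) ^ c * (1 - (s - τ) / (t - τ)) := by gcongr
    _ = 1 / (s - τ) ^ c * ((t - s) / (t - τ)) := by
        rw [one_sub_div ht.ne', sub_sub_sub_cancel_right]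

lemma integral_rlKernel_mul_rlKernel (ha : 0 < a) (hb : 0 < b) (hus : u < s) :
    ∫ τ in u..s, 1 / (s - τ) ^ (1 - a) * (1 / (τ - u) ^ (1 - b)) =
      Real.Gamma a * Real.Gamma b / Real.Gamma (a + b) * (1 / (s - u) ^ (1 - (a + b))) := by
  have hd : 0 < s - u := sub_pos.2 hus
  have hone_div : ∀ {v r : ℝ}, 0 ≤ v → 1 / v ^ (1 - r) = v ^ (r - 1) := fun hv => by
    rw [one_div, ← Real.rpow_neg hv, neg_sub]
  have hscaled := Complex.betaIntegral_scaled b a hd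
  rw [Complex.betaIntegral_eq_Gamma_mul_div _ _ (by simpa) (by simpa)] at hscaled
  have hreal : ∫ v in (0 : ℝ)..(s - u), (v : ℂ) ^ ((b : ℂ) - 1) * (↑(s - u) - v) ^ ((a : ℂ) - 1) =
      ((∫ v in (0 : ℝ)..(s - u), v ^ (b - 1) * (s - u - v) ^ (a - 1) : ℝ) : ℂ) := by
    rw [← intervalIntegral.integral_ofReal]
    refine intervalIntegral.integral_congr fun v hv => ?_
    rw [uIcc_of_le hd.le] at hv
    simp [Complex.ofReal_cpow hv.1, Complex.ofReal_cpow (sub_nonneg.2 hv.2)]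
  calc ∫ τ in u..s, 1 / (s - τ) ^ (1 - a) * (1 / (τ - u) ^ (1 - b))
      = ∫ v in (0 : ℝ)..(s - u), v ^ (b - 1) * (s - u - v) ^ (a - 1) := by
        rw [← sub_self u, ← intervalIntegral.integral_comp_sub_right
          (fun v => v ^ (b - 1) * (s - u - v) ^ (a - 1)) u]
        refine intervalIntegral.integral_congr fun τ hτ => ?_
        rw [uIcc_of_le hus.le] at hτ
        simp only [hone_div (sub_nonneg.2 hτ.1), hone_div (sub_nonneg.2 hτ.2),
          sub_sub_sub_cancel_right, mul_comm]
    _ = (s - u) ^ (b + a - 1) * (Real.Gamma b * Real.Gamma a / Real.Gamma (b + a)) := by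
        apply Complex.ofReal_injective
        rw [← hreal, hscaled]
        push_cast [Complex.ofReal_cpow hd.le, ← Complex.Gamma_ofReal]
        rfl
    _ = _ := by rw [hone_div hd.le, add_comm b a, mul_comm, mul_comm (Real.Gamma b)]

lemma intervalIntegrable_rlKernel_mul_rlKernel (ha : 0 < a) (hb : 0 < b) (hus : u < s) :
    IntervalIntegrable (fun τ => 1 / (s - τ) ^ (1 - a) * (1 / (τ - u) ^ (1 - b))) volume u s := by
  refine intervalIntegral.intervalIntegrable_of_integral_ne_zero ?_
  rw [integral_rlKernel_mul_rlKernel ha hb hus]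
  have := Real.Gamma_pos_of_pos ha
  have := Real.Gamma_pos_of_pos hb
  have := Real.Gamma_pos_of_pos (add_pos ha hb)
  have := sub_pos.2 hus
  positivity

end Kernel

section Semigroup

variable {E : Type*} [NormedAddCommGroup E] [NormedSpace ℝ E]

lemma integral_integral_swap_triangle {a b : ℝ} (hab : a ≤ b) {F : ℝ → ℝ → E}
    (hF : Integrable ({p : ℝ × ℝ | p.2 < p.1}.indicator (Function.uncurry F))
      ((volume.restrict (Ioc a b)).prod (volume.restrict (Ioc a b)))) :
    ∫ τ in a..b, ∫ u in a..τ, F τ u = ∫ u in a..b, ∫ τ in u..b, F τ u := by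
  have hleft : ∀ τ ∈ Ioc a b, ∫ u in a..τ, F τ u = ∫ u in Ioc a b, (Iio τ).indicator (F τ) u := by
    intro τ hτ
    have hinter : Ioc a b ∩ Iio τ = Ioo a τ := by grind
    rw [setIntegral_indicator measurableSet_Iio, hinter, ← integral_Ioc_eq_integral_Ioo,
      intervalIntegral.integral_of_le hτ.1.le]
  have hright : ∀ u ∈ Ioc a b,
      ∫ τ in u..b, F τ u = ∫ τ in Ioc a b, (Ioi u).indicator (fun τ => F τ u) τ := by
    intro u hu
    have hinter : Ioc a b ∩ Ioi u = Ioc u b := by grind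
    rw [setIntegral_indicator measurableSet_Ioi, hinter, intervalIntegral.integral_of_le hu.2]
  rw [intervalIntegral.integral_of_le hab, intervalIntegral.integral_of_le hab,
    setIntegral_congr_fun measurableSet_Ioc hleft, setIntegral_congr_fun measurableSet_Ioc hright]
  exact integral_integral_swap hF

lemma aestronglyMeasurable_of_rlKernel_smul {c s : ℝ} {f : ℝ → E}
    (hf : AEStronglyMeasurable (fun u => (1 / (s - u) ^ c) • f u) (volume.restrict (Ioc 0 s))) :
    AEStronglyMeasurable f (volume.restrict (Ioc 0 s)) := by
  have hpow : Measurable fun u => (s - u) ^ c := by fun_prop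
  refine (hpow.aestronglyMeasurable.smul hf).congr ?_
  filter_upwards [ae_restrict_mem measurableSet_Ioc, ae_restrict_of_ae (volume.ae_ne s)]
    with u hu hus
  have hpos : 0 < s - u := sub_pos.2 (hu.2.lt_of_ne hus)
  change (s - u) ^ c • (1 / (s - u) ^ c) • f u = f u
  rw [smul_smul, mul_one_div_cancel (Real.rpow_pos_of_pos hpos c).ne', one_smul]

lemma integrable_triangle_rlKernel_mul_rlKernel_smul {a b s : ℝ} (ha : 0 < a) (hb : 0 < b)
    (hs : 0 ≤ s) {f : ℝ → E}
    (hf : IntervalIntegrable (fun u => (1 / (s - u) ^ (1 - (a + b))) • f u) volume 0 s) :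
    Integrable ({p : ℝ × ℝ | p.2 < p.1}.indicator (Function.uncurry fun τ u =>
        (1 / (s - τ) ^ (1 - a) * (1 / (τ - u) ^ (1 - b))) • f u))
      ((volume.restrict (Ioc 0 s)).prod (volume.restrict (Ioc 0 s))) := by
  rw [intervalIntegrable_iff_integrableOn_Ioc_of_le hs] at hf
  have hmeas : AEStronglyMeasurable ({p : ℝ × ℝ | p.2 < p.1}.indicator (Function.uncurry fun τ u =>
        (1 / (s - τ) ^ (1 - a) * (1 / (τ - u) ^ (1 - b))) • f u))
      ((volume.restrict (Ioc 0 s)).prod (volume.restrict (Ioc 0 s))) := by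
    refine AEStronglyMeasurable.indicator ?_ (measurableSet_lt measurable_snd measurable_fst)
    refine AEStronglyMeasurable.smul (Measurable.aestronglyMeasurable (by fun_prop)) ?_
    exact (aestronglyMeasurable_of_rlKernel_smul hf.1).comp_snd
  have hmem : ∀ᵐ u ∂(volume.restrict (Ioc 0 s)), u ∈ Ioo 0 s := by
    rw [← restrict_Ioo_eq_restrict_Ioc]
    exact ae_restrict_mem measurableSet_Ioo
  have hslice : ∀ u τ, {p : ℝ × ℝ | p.2 < p.1}.indicator (Function.uncurry fun τ u =>
        (1 / (s - τ) ^ (1 - a) * (1 / (τ - u) ^ (1 - b))) • f u) (τ, u) =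
      (Ioi u).indicator (fun τ => (1 / (s - τ) ^ (1 - a) * (1 / (τ - u) ^ (1 - b))) • f u) τ :=
    fun _ _ => rfl
  have hinter : ∀ u ∈ Ioo 0 s, Ioc 0 s ∩ Ioi u = Ioc u s := by grind
  refine (integrable_prod_iff' hmeas).2 ⟨?_, ?_⟩
  · filter_upwards [hmem] with u hu
    have hint := intervalIntegrable_rlKernel_mul_rlKernel ha hb hu.2
    rw [intervalIntegrable_iff_integrableOn_Ioc_of_le hu.2.le] at hint
    simp only [hslice]
    rw [integrable_indicator_iff measurableSet_Ioi, IntegrableOn,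
      Measure.restrict_restrict measurableSet_Ioi, inter_comm, hinter u hu]
    exact hint.smul_const _
  · refine (hf.norm.const_mul (Real.Gamma a * Real.Gamma b / Real.Gamma (a + b))).congr ?_
    filter_upwards [hmem] with u hu
    have hsu : 0 ≤ s - u := sub_nonneg.2 hu.2.le
    simp only [hslice, norm_indicator_eq_indicator_norm]
    rw [setIntegral_indicator measurableSet_Ioi, hinter u hu, norm_smul,
      Real.norm_of_nonneg (by positivity), ← mul_assoc, ← integral_rlKernel_mul_rlKernel ha hb hu.2,
      intervalIntegral.integral_of_le hu.2.le, ← integral_mul_const]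
    refine setIntegral_congr_fun measurableSet_Ioc fun τ hτ => ?_
    have hsτ : 0 ≤ s - τ := sub_nonneg.2 hτ.2
    have hτu : 0 ≤ τ - u := sub_nonneg.2 hτ.1.le
    simp only [norm_smul]
    rw [Real.norm_of_nonneg (by positivity)]

lemma rlIntegral_rlIntegral [CompleteSpace E] {a b s : ℝ} (ha : 0 < a) (hb : 0 < b) (hs : 0 ≤ s)
    {f : ℝ → E}
    (hf : IntervalIntegrable (fun u => (1 / (s - u) ^ (1 - (a + b))) • f u) volume 0 s) :
    rlIntegral a (rlIntegral b f) s = rlIntegral (a + b) f s := by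
  have hΓa := (Real.Gamma_pos_of_pos ha).ne'
  have hΓb := (Real.Gamma_pos_of_pos hb).ne'
  have hinner : ∀ u ∈ Ioo 0 s,
      ∫ τ in u..s, (1 / (s - τ) ^ (1 - a) * (1 / (τ - u) ^ (1 - b))) • f u =
        (Real.Gamma a * Real.Gamma b / Real.Gamma (a + b)) •
          (1 / (s - u) ^ (1 - (a + b))) • f u := fun u hu => by
    rw [intervalIntegral.integral_smul_const, integral_rlKernel_mul_rlKernel ha hb hu.2, mul_smul]
  calc rlIntegral a (rlIntegral b f) s
      = (1 / Real.Gamma a * (1 / Real.Gamma b)) • ∫ τ in (0 : ℝ)..s, ∫ u in (0 : ℝ)..τ,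
          (1 / (s - τ) ^ (1 - a) * (1 / (τ - u) ^ (1 - b))) • f u := by
        simp only [rlIntegral, smul_comm _ (1 / Real.Gamma b), intervalIntegral.integral_smul,
          mul_smul]
    _ = (1 / Real.Gamma a * (1 / Real.Gamma b)) • ∫ u in (0 : ℝ)..s, ∫ τ in u..s,
          (1 / (s - τ) ^ (1 - a) * (1 / (τ - u) ^ (1 - b))) • f u := by
        rw [integral_integral_swap_triangle hs
          (integrable_triangle_rlKernel_mul_rlKernel_smul ha hb hs hf)]
    _ = (1 / Real.Gamma a * (1 / Real.Gamma b)) •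
          (Real.Gamma a * Real.Gamma b / Real.Gamma (a + b)) •
            ∫ u in (0 : ℝ)..s, (1 / (s - u) ^ (1 - (a + b))) • f u := by
        congr 1
        rw [← intervalIntegral.integral_smul]
        refine intervalIntegral.integral_congr_uIoo fun u hu => hinner u ?_
        rwa [uIoo_of_le hs] at hu
    _ = rlIntegral (a + b) f s := by
        rw [smul_smul, rlIntegral]
        congr 1
        field_simp

lemma rlIntegral_one (f : ℝ → E) (t : ℝ) : rlIntegral 1 f t = ∫ τ in (0 : ℝ)..t, f τ := by
  simp [rlIntegral]

end Semigroup

section KernelIntegral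

variable {E : Type*} [NormedAddCommGroup E] [NormedSpace ℝ E] {a c s t β C M : ℝ} {f g : ℝ → E}

lemma rlKernelIntegral_congr (hs : 0 ≤ s) (hfg : EqOn f g (Icc 0 s)) :
    rlKernelIntegral c f s = rlKernelIntegral c g s := by
  refine intervalIntegral.integral_congr fun τ hτ => ?_
  rw [uIcc_of_le hs] at hτ
  simp only [hfg hτ]

lemma rlKernelIntegral_eq_smul_rlIntegral (hc : c < 1) (f : ℝ → E) (t : ℝ) :
    rlKernelIntegral c f t = Real.Gamma (1 - c) • rlIntegral (1 - c) f t := by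
  have hΓ := (Real.Gamma_pos_of_pos (sub_pos.2 hc)).ne'
  rw [rlIntegral, rlKernelIntegral, smul_smul, mul_one_div_cancel hΓ, one_smul, sub_sub_cancel]

lemma rlIntegral_eq_smul_rlKernelIntegral (a : ℝ) (f : ℝ → E) (t : ℝ) :
    rlIntegral a f t = (1 / Real.Gamma a) • rlKernelIntegral (1 - a) f t := rfl

lemma intervalIntegrable_rlKernel_smul_of_memLp_top (hc : c < 1) (hat : a ≤ t)
    (hf : MemLp f ⊤ (volume.restrict (Icc a t))) :
    IntervalIntegrable (fun τ => (1 / (t - τ) ^ c) • f τ) volume a t := by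
  have hk := intervalIntegrable_rlKernel hc hat le_rfl
  rw [intervalIntegrable_iff_integrableOn_Icc_of_le hat] at hk ⊢
  exact hk.smul_of_top_left hf

lemma intervalIntegrable_rlKernel_smul_of_continuousOn (hc : c < 1) (hat : a ≤ t)
    (hf : ContinuousOn f (Icc a t)) :
    IntervalIntegrable (fun τ => (1 / (t - τ) ^ c) • f τ) volume a t :=
  (intervalIntegrable_rlKernel hc hat le_rfl).smul_continuousOn (by rwa [uIcc_of_le hat])

lemma rlKernelIntegral_sub (hs : 0 ≤ s) (hst : s ≤ t)
    (hft : IntervalIntegrable (fun τ => (1 / (t - τ) ^ c) • f τ) volume 0 t)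
    (hfs : IntervalIntegrable (fun τ => (1 / (s - τ) ^ c) • f τ) volume 0 s) :
    rlKernelIntegral c f t - rlKernelIntegral c f s =
      (∫ τ in s..t, (1 / (t - τ) ^ c) • f τ) -
        ∫ τ in (0 : ℝ)..s, (1 / (s - τ) ^ c - 1 / (t - τ) ^ c) • f τ := by
  have hsmem : s ∈ uIcc 0 t := by simp [uIcc_of_le (hs.trans hst), hs, hst]
  have hnear := hft.mono_set (uIcc_subset_uIcc_right hsmem)
  have hfar := hft.mono_set (uIcc_subset_uIcc_left hsmem)
  simp only [sub_smul]
  rw [intervalIntegral.integral_sub hfs hfar, rlKernelIntegral, rlKernelIntegral,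
    ← intervalIntegral.integral_add_adjacent_intervals hfar hnear]
  abel

lemma norm_integral_rlKernel_smul_le_of_le_rpow (hcβ : c < 1 + β) (hst : s ≤ t)
    (hf : ∀ᵐ τ, τ ∈ Ioc s t → ‖f τ‖ ≤ C * (t - τ) ^ β) :
    ‖∫ τ in s..t, (1 / (t - τ) ^ c) • f τ‖ ≤ C * ((t - s) ^ (1 + (β - c)) / (1 + (β - c))) := by
  have hkernel : c - β < 1 := by linarith
  have hint : ∫ τ in s..t, C * (1 / (t - τ) ^ (c - β)) =
      C * ((t - s) ^ (1 + (β - c)) / (1 + (β - c))) := by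
    rw [intervalIntegral.integral_const_mul, integral_rlKernel_self hkernel hst,
      show 1 - (c - β) = 1 + (β - c) by ring]
  rw [← hint]
  refine intervalIntegral.norm_integral_le_of_norm_le hst ?_
    ((intervalIntegrable_rlKernel hkernel hst le_rfl).const_mul C)
  filter_upwards [hf, volume.ae_ne t] with τ hfτ hτt hτ
  have hpos : 0 < t - τ := sub_pos.2 (hτ.2.lt_of_ne hτt)
  rw [norm_smul, Real.norm_of_nonneg (by positivity)]
  calc 1 / (t - τ) ^ c * ‖f τ‖ ≤ 1 / (t - τ) ^ c * (C * (t - τ) ^ β) := by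
        gcongr
        exact hfτ hτ
    _ = C * (1 / (t - τ) ^ (c - β)) := by
        rw [Real.rpow_sub hpos]
        field_simp

lemma norm_integral_rlKernel_sub_smul_le (hc0 : 0 ≤ c) (hc : c < 1) (hs : 0 ≤ s) (hst : s ≤ t)
    (hM : 0 ≤ M) (hf : ∀ᵐ τ, τ ∈ Ioc 0 s → ‖f τ‖ ≤ M) :
    ‖∫ τ in (0 : ℝ)..s, (1 / (s - τ) ^ c - 1 / (t - τ) ^ c) • f τ‖ ≤
      M * ((t - s) ^ (1 - c) / (1 - c)) := by
  have hks := intervalIntegrable_rlKernel hc hs le_rfl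
  have hkt := intervalIntegrable_rlKernel hc (hs.trans hst) hst
  have hc1 : 0 < 1 - c := sub_pos.2 hc
  calc ‖∫ τ in (0 : ℝ)..s, (1 / (s - τ) ^ c - 1 / (t - τ) ^ c) • f τ‖
      ≤ ∫ τ in (0 : ℝ)..s, M * (1 / (s - τ) ^ c - 1 / (t - τ) ^ c) := by
        refine intervalIntegral.norm_integral_le_of_norm_le hs ?_ ((hks.sub hkt).const_mul M)
        filter_upwards [hf, volume.ae_ne s] with τ hfτ hτs hτ
        have hle := sub_nonneg.2 (rlKernel_le_rlKernel hc0 (hτ.2.lt_of_ne hτs) hst)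
        rw [norm_smul, Real.norm_of_nonneg hle, mul_comm]
        gcongr
        exact hfτ hτ
    _ = M * ((s ^ (1 - c) - (t ^ (1 - c) - (t - s) ^ (1 - c))) / (1 - c)) := by
        rw [intervalIntegral.integral_const_mul, intervalIntegral.integral_sub hks hkt,
          integral_rlKernel_self hc hs, integral_rlKernel hc (hs.trans hst) hst, ← sub_div]
        simp only [sub_zero]
    _ ≤ M * ((t - s) ^ (1 - c) / (1 - c)) := by
        gcongr
        linarith [Real.rpow_le_rpow hs hst hc1.le]

lemma norm_rlKernelIntegral_sub_le_of_memLp_top (hc0 : 0 ≤ c) (hc : c < 1) (hs : 0 ≤ s)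
    (hst : s ≤ t) (hf : MemLp f ⊤ (volume.restrict (Icc 0 t))) (hM : 0 ≤ M)
    (hfM : ∀ᵐ τ, τ ∈ Ioc 0 t → ‖f τ‖ ≤ M) :
    ‖rlKernelIntegral c f t - rlKernelIntegral c f s‖ ≤ 2 * M / (1 - c) * (t - s) ^ (1 - c) := by
  have hfs := hf.mono_measure (Measure.restrict_mono_set volume (Icc_subset_Icc_right hst))
  have hnear := norm_integral_rlKernel_smul_le_of_le_rpow (c := c) (f := f) (C := M)
    (β := 0) (by linarith) hst
    (hfM.mono fun τ hτ hmem => by simpa using hτ ⟨hs.trans_lt hmem.1, hmem.2⟩)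
  have hfar := norm_integral_rlKernel_sub_smul_le hc0 hc hs hst hM
    (hfM.mono fun τ hτ hmem => hτ ⟨hmem.1, hmem.2.trans hst⟩)
  rw [zero_sub, ← sub_eq_add_neg] at hnear
  rw [rlKernelIntegral_sub hs hst
    (intervalIntegrable_rlKernel_smul_of_memLp_top hc (hs.trans hst) hf)
    (intervalIntegrable_rlKernel_smul_of_memLp_top hc hs hfs)]
  calc _ ≤ _ := norm_sub_le_of_le hnear hfar
    _ = _ := by ring

lemma norm_integral_rlKernel_sub_smul_le_of_le_rpow (hc0 : 0 ≤ c) (hcβ : c < β) (hβ : β ≤ 1)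
    (hs : 0 ≤ s) (hst : s ≤ t) (hC : 0 ≤ C)
    (hf : ∀ᵐ τ, τ ∈ Ioc 0 s → ‖f τ‖ ≤ C * (t - τ) ^ β) :
    ‖∫ τ in (0 : ℝ)..s, (1 / (s - τ) ^ c - 1 / (t - τ) ^ c) • f τ‖ ≤
      C * (t - s) * (s ^ (β - c) / (β - c)) := by
  have hkernel : 1 - (β - c) < 1 := by linarith
  have hint : ∫ τ in (0 : ℝ)..s, C * (t - s) * (1 / (s - τ) ^ (1 - (β - c))) =
      C * (t - s) * (s ^ (β - c) / (β - c)) := by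
    rw [intervalIntegral.integral_const_mul, integral_rlKernel_self hkernel hs, sub_zero,
      sub_sub_cancel]
  rw [← hint]
  refine intervalIntegral.norm_integral_le_of_norm_le hs ?_
    ((intervalIntegrable_rlKernel hkernel hs le_rfl).const_mul _)
  filter_upwards [hf, volume.ae_ne s] with τ hfτ hτs hτ
  have hτs : τ < s := hτ.2.lt_of_ne hτs
  have hsτ : 0 < s - τ := sub_pos.2 hτs
  have htτ : 0 < t - τ := by linarith
  have : 0 ≤ t - s := sub_nonneg.2 hst
  rw [norm_smul, Real.norm_of_nonneg (sub_nonneg.2 (rlKernel_le_rlKernel hc0 hτs hst))]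
  calc (1 / (s - τ) ^ c - 1 / (t - τ) ^ c) * ‖f τ‖
      ≤ 1 / (s - τ) ^ c * ((t - s) / (t - τ)) * (C * (t - τ) ^ β) := by
        gcongr
        · exact rlKernel_sub_rlKernel_le (hcβ.le.trans hβ) hτs hst
        · exact hfτ hτ
    _ = C * (t - s) * (1 / (s - τ) ^ c * (t - τ) ^ (β - 1)) := by
        rw [Real.rpow_sub_one htτ.ne']
        ring
    _ ≤ C * (t - s) * (1 / (s - τ) ^ c * (s - τ) ^ (β - 1)) := by
        have hanti : (t - τ) ^ (β - 1) ≤ (s - τ) ^ (β - 1) :=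
          Real.rpow_le_rpow_of_nonpos hsτ (by linarith) (by linarith)
        gcongr
    _ = C * (t - s) * (1 / (s - τ) ^ (1 - (β - c))) := by
        rw [one_div, one_div, ← Real.rpow_neg hsτ.le, ← Real.rpow_neg hsτ.le, ← Real.rpow_add hsτ]
        ring_nf

lemma norm_rlKernelIntegral_sub_le_of_le_rpow (hc0 : 0 ≤ c) (hcβ : c < β) (hβ : β ≤ 1)
    (hs : 0 ≤ s) (hst : s ≤ t) (hC : 0 ≤ C)
    (hf : ∀ᵐ τ, τ ∈ Ioc 0 t → ‖f τ‖ ≤ C * (t - τ) ^ β)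
    (hft : IntervalIntegrable (fun τ => (1 / (t - τ) ^ c) • f τ) volume 0 t)
    (hfs : IntervalIntegrable (fun τ => (1 / (s - τ) ^ c) • f τ) volume 0 s) :
    ‖rlKernelIntegral c f t - rlKernelIntegral c f s‖ ≤
      2 * C * t ^ (β - c) / (β - c) * (t - s) := by
  have : 0 < β - c := sub_pos.2 hcβ
  have hts : 0 ≤ t - s := sub_nonneg.2 hst
  have hnear : ‖∫ τ in s..t, (1 / (t - τ) ^ c) • f τ‖ ≤
      C * (((t - s) * t ^ (β - c)) / (β - c)) := by
    refine (norm_integral_rlKernel_smul_le_of_le_rpow (by linarith) hst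
      (hf.mono fun τ hτ hmem => hτ ⟨hs.trans_lt hmem.1, hmem.2⟩)).trans ?_
    rw [Real.rpow_one_add' hts (by linarith)]
    have ht : 0 ≤ t := hs.trans hst
    gcongr <;> linarith
  have hfar : ‖∫ τ in (0 : ℝ)..s, (1 / (s - τ) ^ c - 1 / (t - τ) ^ c) • f τ‖ ≤
      C * (t - s) * (t ^ (β - c) / (β - c)) := by
    refine (norm_integral_rlKernel_sub_smul_le_of_le_rpow hc0 hcβ hβ hs hst hC
      (hf.mono fun τ hτ hmem => hτ ⟨hmem.1, hmem.2.trans hst⟩)).trans ?_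
    gcongr
  rw [rlKernelIntegral_sub hs hst hft hfs]
  calc _ ≤ _ := norm_sub_le_of_le hnear hfar
    _ = _ := by ring

end KernelIntegral

section Holder

variable {E : Type*} [NormedAddCommGroup E] {A : Set ℝ} {f : ℝ → E}

lemma norm_sub_le_of_holderOnWith {C r : ℝ≥0} (hf : HolderOnWith C r f A) {s t : ℝ} (hs : s ∈ A)
    (ht : t ∈ A) (hst : s ≤ t) : ‖f t - f s‖ ≤ C * (t - s) ^ (r : ℝ) := by
  simpa [dist_eq_norm, Real.norm_of_nonneg (sub_nonneg.2 hst)] using hf.dist_le ht hs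

lemma holderOnWith_of_norm_sub_le {C r : ℝ} (hr : 0 ≤ r)
    (hf : ∀ s ∈ A, ∀ t ∈ A, s ≤ t → ‖f t - f s‖ ≤ C * (t - s) ^ r) :
    HolderOnWith C.toNNReal r.toNNReal f A := by
  intro s hs t ht
  wlog hst : s ≤ t generalizing s t
  · rw [edist_comm, edist_comm s t]
    exact this t ht s hs (le_of_not_ge hst)
  have hts : 0 ≤ t - s := sub_nonneg.2 hst
  rw [edist_comm, edist_comm s t, edist_dist, edist_dist, dist_eq_norm, Real.dist_eq,
    abs_of_nonneg hts, Real.coe_toNNReal r hr, ENNReal.ofReal_rpow_of_nonneg hts hr]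
  refine (ENNReal.ofReal_le_ofReal (hf s hs t ht hst)).trans ?_
  rw [ENNReal.ofReal_mul' (by positivity)]
  rfl

lemma lipschitzOnWith_of_norm_sub_le {C : ℝ}
    (hf : ∀ s ∈ A, ∀ t ∈ A, s ≤ t → ‖f t - f s‖ ≤ C * (t - s)) :
    LipschitzOnWith C.toNNReal f A := by
  rw [← holderOnWith_one, ← Real.toNNReal_one]
  exact holderOnWith_of_norm_sub_le zero_le_one (by simpa using hf)

end Holder

section Representation

variable {E : Type*} [NormedAddCommGroup E] {α s T : ℝ} {f g φ x y : ℝ → E}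

lemma intervalIntegrable_of_memLp_top (hφ : MemLp φ ⊤ (volume.restrict (Icc 0 T)))
    (hs : s ∈ Icc 0 T) : IntervalIntegrable φ volume 0 s := by
  rw [intervalIntegrable_iff_integrableOn_Icc_of_le hs.1]
  exact IntegrableOn.mono_set (hφ.integrable le_top) (Icc_subset_Icc_right hs.2)

variable [NormedSpace ℝ E]

lemma exists_holderOnWith_rlIntegral (hα : α ∈ Ioo 0 1)
    (hφ : MemLp φ ⊤ (volume.restrict (Icc 0 T))) :
    ∃ H, HolderOnWith H α.toNNReal (rlIntegral α φ) (Icc 0 T) := by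
  have hΓ := Real.Gamma_pos_of_pos hα.1
  have hbound := (ae_restrict_iff' measurableSet_Icc).1 (ae_le_lpNorm_exponent_top hφ)
  set M := lpNorm φ ⊤ (volume.restrict (Icc 0 T))
  refine ⟨_, holderOnWith_of_norm_sub_le (C := 1 / Real.Gamma α * (2 * M / α)) hα.1.le
    fun s hs t ht hst => ?_⟩
  have hkernel := norm_rlKernelIntegral_sub_le_of_memLp_top (sub_nonneg.2 hα.2.le)
    (sub_lt_self 1 hα.1) hs.1 hst
    (hφ.mono_measure (Measure.restrict_mono_set volume (Icc_subset_Icc_right ht.2)))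
    lpNorm_nonneg (hbound.mono fun τ hτ hmem => hτ ⟨hmem.1.le, hmem.2.trans ht.2⟩)
  rw [sub_sub_cancel] at hkernel
  rw [rlIntegral_eq_smul_rlKernelIntegral, rlIntegral_eq_smul_rlKernelIntegral, ← smul_sub,
    norm_smul, Real.norm_of_nonneg (by positivity), mul_assoc]
  gcongr

lemma MemRLIntegralLinfty.congr (hx : MemRLIntegralLinfty α T x) (hxy : EqOn x y (Icc 0 T)) :
    MemRLIntegralLinfty α T y := by
  obtain ⟨φ, hφ, hxφ⟩ := hx
  exact ⟨φ, hφ, fun t ht => (hxy ht).symm.trans (hxφ t ht)⟩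

lemma MemRLIntegralLinfty.apply_zero (hx : MemRLIntegralLinfty α T x) (hT : 0 ≤ T) : x 0 = 0 := by
  obtain ⟨φ, -, hxφ⟩ := hx
  simp [hxφ 0 (left_mem_Icc.2 hT), rlIntegral]

lemma MemRLIntegralLinfty.exists_holderOnWith (hx : MemRLIntegralLinfty α T x)
    (hα : α ∈ Ioo 0 1) : ∃ H, HolderOnWith H α.toNNReal x (Icc 0 T) := by
  obtain ⟨φ, hφ, hxφ⟩ := hx
  obtain ⟨H, hH⟩ := exists_holderOnWith_rlIntegral hα hφ
  refine ⟨H, fun s hs t ht => ?_⟩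
  rw [hxφ s hs, hxφ t ht]
  exact hH s hs t ht

lemma MemRLIntegralLinfty.continuousOn (hx : MemRLIntegralLinfty α T x) (hα : α ∈ Ioo 0 1) :
    ContinuousOn x (Icc 0 T) := by
  obtain ⟨H, hH⟩ := hx.exists_holderOnWith hα
  exact hH.continuousOn (Real.toNNReal_pos.2 hα.1)

variable [CompleteSpace E]

lemma rlKernelIntegral_rlIntegral (hα : α ∈ Ioo 0 1) (hs : 0 ≤ s)
    (hφ : IntervalIntegrable φ volume 0 s) :
    rlKernelIntegral α (rlIntegral α φ) s = Real.Gamma (1 - α) • ∫ u in (0 : ℝ)..s, φ u := by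
  rw [rlKernelIntegral_eq_smul_rlIntegral hα.2,
    rlIntegral_rlIntegral (sub_pos.2 hα.2) hα.1 hs (by simpa using hφ), sub_add_cancel,
    rlIntegral_one]

lemma rlIntegral_rlKernelIntegral (hα : α ∈ Ioo 0 1) (hs : 0 ≤ s)
    (hφ : IntervalIntegrable φ volume 0 s) :
    rlIntegral α (rlKernelIntegral α φ) s = Real.Gamma (1 - α) • ∫ u in (0 : ℝ)..s, φ u := by
  have hsemigroup := rlIntegral_rlIntegral hα.1 (sub_pos.2 hα.2) hs (f := φ) (by simpa using hφ)
  rw [add_sub_cancel, rlIntegral_one] at hsemigroup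
  rw [← hsemigroup]
  simp only [rlIntegral, funext (rlKernelIntegral_eq_smul_rlIntegral hα.2 φ),
    smul_comm _ (Real.Gamma (1 - α)), intervalIntegral.integral_smul]

lemma MemRLIntegralLinfty.exists_rlKernelIntegral_eq_integral (hx : MemRLIntegralLinfty α T x)
    (hα : α ∈ Ioo 0 1) : ∃ φ : ℝ → E, MemLp φ ⊤ (volume.restrict (Icc 0 T)) ∧
      ∀ t ∈ Icc 0 T, rlKernelIntegral α x t = Real.Gamma (1 - α) • ∫ u in (0 : ℝ)..t, φ u := by
  obtain ⟨φ, hφ, hxφ⟩ := hx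
  refine ⟨φ, hφ, fun t ht => ?_⟩
  rw [← rlKernelIntegral_rlIntegral hα ht.1 (intervalIntegrable_of_memLp_top hφ ht)]
  exact rlKernelIntegral_congr ht.1 fun τ hτ => hxφ τ ⟨hτ.1, hτ.2.trans ht.2⟩

lemma MemRLIntegralLinfty.exists_lipschitzOnWith_rlKernelIntegral
    (hx : MemRLIntegralLinfty α T x) (hα : α ∈ Ioo 0 1) :
    ∃ L, LipschitzOnWith L (rlKernelIntegral α x) (Icc 0 T) := by
  obtain ⟨φ, hφ, hxφ⟩ := hx.exists_rlKernelIntegral_eq_integral hα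
  have hΓ := Real.Gamma_pos_of_pos (sub_pos.2 hα.2)
  have hbound := (ae_restrict_iff' measurableSet_Icc).1 (ae_le_lpNorm_exponent_top hφ)
  refine ⟨_, lipschitzOnWith_of_norm_sub_le
    (C := Real.Gamma (1 - α) * lpNorm φ ⊤ (volume.restrict (Icc 0 T))) fun s hs t ht hst => ?_⟩
  have hintegral := intervalIntegral.norm_integral_le_of_norm_le_const_ae (a := s) (b := t)
    (f := φ) (hbound.mono fun τ hτ hmem => hτ ?_)
  · rw [abs_of_nonneg (sub_nonneg.2 hst)] at hintegral
    rw [hxφ s hs, hxφ t ht, ← smul_sub, intervalIntegral.integral_interval_sub_left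
      (intervalIntegrable_of_memLp_top hφ ht) (intervalIntegrable_of_memLp_top hφ hs),
      norm_smul, Real.norm_of_nonneg hΓ.le, mul_assoc]
    gcongr
  · rw [uIoc_of_le hst] at hmem
    exact ⟨hs.1.trans hmem.1.le, hmem.2.trans ht.2⟩

lemma MemRLIntegralLinfty.ae_hasRLDerivative (hx : MemRLIntegralLinfty α T x)
    (hα : α ∈ Ioo 0 1) (hT : 0 ≤ T) :
    ∀ᵐ t ∂(volume.restrict (Icc 0 T)), HasRLDerivative α T x t := by
  obtain ⟨φ, hφ, hxφ⟩ := hx.exists_rlKernelIntegral_eq_integral hα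
  have hderiv := (intervalIntegrable_of_memLp_top hφ (right_mem_Icc.2 hT)).ae_hasDerivAt_integral
  filter_upwards [ae_restrict_of_ae hderiv, ae_restrict_mem measurableSet_Icc] with t ht htmem
  rw [uIcc_of_le hT] at ht
  refine ⟨fun s hs => intervalIntegrable_rlKernel_smul_of_continuousOn hα.2 hs.1
    ((hx.continuousOn hα).mono (Icc_subset_Icc_right hs.2)), ?_⟩
  have hdiff := (ht htmem 0 (left_mem_Icc.2 hT)).differentiableAt.const_smul (Real.Gamma (1 - α))
  exact hdiff.differentiableWithinAt.congr hxφ (hxφ t htmem)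

lemma eqOn_of_eqOn_rlKernelIntegral (hα : α ∈ Ioo 0 1) (hT : 0 < T)
    (hf : ContinuousOn f (Icc 0 T)) (hg : ContinuousOn g (Icc 0 T))
    (hfg : EqOn (rlKernelIntegral α f) (rlKernelIntegral α g) (Icc 0 T)) :
    EqOn f g (Icc 0 T) := by
  have hinterval : ∀ {h : ℝ → E}, ContinuousOn h (Icc 0 T) → ∀ s ∈ Icc 0 T,
      IntervalIntegrable h volume 0 s := fun hh s hs =>
    (hh.mono (by simpa [uIcc_of_le hs.1] using Icc_subset_Icc_right hs.2)).intervalIntegrable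
  have hprimitive : EqOn (fun s => ∫ u in (0 : ℝ)..s, f u) (fun s => ∫ u in (0 : ℝ)..s, g u)
      (Icc 0 T) := by
    intro s hs
    refine smul_right_injective E (Real.Gamma_pos_of_pos (sub_pos.2 hα.2)).ne' ?_
    change Real.Gamma (1 - α) • ∫ u in (0 : ℝ)..s, f u = Real.Gamma (1 - α) • ∫ u in (0 : ℝ)..s, g u
    rw [← rlIntegral_rlKernelIntegral hα hs.1 (hinterval hf s hs),
      ← rlIntegral_rlKernelIntegral hα hs.1 (hinterval hg s hs),
      rlIntegral_eq_smul_rlKernelIntegral, rlIntegral_eq_smul_rlKernelIntegral,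
      rlKernelIntegral_congr hs.1 (hfg.mono (Icc_subset_Icc_right hs.2))]
  have hderiv : ∀ {h : ℝ → E}, ContinuousOn h (Icc 0 T) → ∀ t ∈ Icc 0 T,
      HasDerivWithinAt (fun s => ∫ u in (0 : ℝ)..s, h u) (h t) (Icc 0 T) t := fun hh t ht => by
    have := Fact.mk ht
    exact intervalIntegral.integral_hasDerivWithinAt_right (hinterval hh t ht)
      (hh.stronglyMeasurableAtFilter_nhdsWithin measurableSet_Icc t) (hh t ht)
  intro t ht
  exact (uniqueDiffOn_Icc hT t ht).eq_deriv _ (hderiv hf t ht)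
    ((hderiv hg t ht).congr hprimitive (hprimitive ht))

lemma memRLIntegralLinfty_of_lipschitzOnWith {y : ℝ → ℝ} (hα : α ∈ Ioo 0 1) (hT : 0 < T)
    (hy : ContinuousOn y (Icc 0 T)) {L : ℝ≥0}
    (hL : LipschitzOnWith L (rlKernelIntegral α y) (Icc 0 T)) : MemRLIntegralLinfty α T y := by
  have hΓ := Real.Gamma_pos_of_pos (sub_pos.2 hα.2)
  set G := rlKernelIntegral α y with hG
  have hderiv : MemLp (deriv G) ⊤ (volume.restrict (Icc 0 T)) := by
    refine memLp_top_of_bound (stronglyMeasurable_deriv G).aestronglyMeasurable L ?_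
    rw [← restrict_Ioo_eq_restrict_Icc]
    filter_upwards [ae_restrict_mem measurableSet_Ioo] with t ht
    exact norm_deriv_le_of_lipschitzOn (Icc_mem_nhds ht.1 ht.2) hL
  have hψ := hderiv.const_mul (1 / Real.Gamma (1 - α))
  have hprimitive : ∀ s ∈ Icc 0 T,
      Real.Gamma (1 - α) • ∫ u in (0 : ℝ)..s, 1 / Real.Gamma (1 - α) * deriv G u = G s := by
    intro s hs
    have hftc : ∫ u in (0 : ℝ)..s, deriv G u = G s - G 0 :=
      (hL.mono (by simpa [uIcc_of_le hs.1] using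
        Icc_subset_Icc_right hs.2)).absolutelyContinuousOnInterval.integral_deriv_eq_sub
    have hG0 : G 0 = 0 := by simp [hG, rlKernelIntegral]
    rw [intervalIntegral.integral_const_mul, hftc, hG0, sub_zero, smul_eq_mul,
      one_div, mul_inv_cancel_left₀ hΓ.ne']
  obtain ⟨H, hH⟩ := exists_holderOnWith_rlIntegral hα hψ
  refine ⟨_, hψ, eqOn_of_eqOn_rlKernelIntegral hα hT hy
    (hH.continuousOn (Real.toNNReal_pos.2 hα.1)) fun s hs => ?_⟩
  rw [rlKernelIntegral_rlIntegral hα hs.1 (intervalIntegrable_of_memLp_top hψ hs),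
    hprimitive s hs]

end Representation

section NormSq

variable {E : Type*} [NormedAddCommGroup E] {α s t T : ℝ} {H γ : ℝ≥0} {x : ℝ → E}

lemma norm_sub_sq_le_of_holderOnWith {A : Set ℝ} (hx : HolderOnWith H γ x A) (hs : s ∈ A)
    (ht : t ∈ A) (hst : s ≤ t) : ‖x s - x t‖ ^ 2 ≤ H ^ 2 * (t - s) ^ (2 * γ : ℝ) := by
  calc ‖x s - x t‖ ^ 2 ≤ (H * (t - s) ^ (γ : ℝ)) ^ 2 := by
        rw [norm_sub_rev]
        gcongr
        exact norm_sub_le_of_holderOnWith hx hs ht hst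
    _ = H ^ 2 * (t - s) ^ (2 * γ : ℝ) := by
        rw [mul_pow, mul_comm 2, Real.rpow_mul (sub_nonneg.2 hst), Real.rpow_two]

lemma norm_le_mul_rpow_of_holderOnWith (hx : HolderOnWith H γ x (Icc 0 T)) (hx0 : x 0 = 0)
    (ht : t ∈ Icc 0 T) : ‖x t‖ ≤ H * T ^ (γ : ℝ) := by
  have hxt : ‖x t‖ ≤ H * t ^ (γ : ℝ) := by
    simpa [hx0] using
      norm_sub_le_of_holderOnWith hx (left_mem_Icc.2 (ht.1.trans ht.2)) ht ht.1
  refine hxt.trans ?_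
  gcongr
  exacts [ht.1, ht.2]

lemma rpow_mul_rpow_sub_rpow_le (hα : 0 ≤ α) (hs : 0 ≤ s) (hst : s ≤ t) :
    t ^ α * (t ^ (1 - α) - s ^ (1 - α)) ≤ t - s := by
  have hsplit : ∀ u : ℝ, 0 ≤ u → u ^ α * u ^ (1 - α) = u := fun u hu => by
    rw [← Real.rpow_add' hu (by simp), add_sub_cancel, Real.rpow_one]
  calc t ^ α * (t ^ (1 - α) - s ^ (1 - α)) = t - t ^ α * s ^ (1 - α) := by
        rw [mul_sub, hsplit t (hs.trans hst)]
    _ ≤ t - s ^ α * s ^ (1 - α) := by gcongr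
    _ = t - s := by rw [hsplit s hs]

lemma norm_sq_mul_rpow_sub_rpow_le (hα0 : 0 ≤ α) (hα1 : α ≤ 1) (hγ : α ≤ 2 * γ)
    (hx : HolderOnWith H γ x (Icc 0 T)) (hx0 : x 0 = 0) (hs : 0 ≤ s) (hst : s ≤ t) (htT : t ≤ T) :
    ‖x t‖ ^ 2 * (t ^ (1 - α) - s ^ (1 - α)) ≤ H ^ 2 * T ^ (2 * γ - α) * (t - s) := by
  have ht : 0 ≤ t := hs.trans hst
  have hxt : ‖x t‖ ^ 2 ≤ H ^ 2 * t ^ (2 * γ : ℝ) := by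
    simpa [hx0] using
      norm_sub_sq_le_of_holderOnWith hx (left_mem_Icc.2 (ht.trans htT)) ⟨ht, htT⟩ ht
  have hmono : 0 ≤ t ^ (1 - α) - s ^ (1 - α) :=
    sub_nonneg.2 (Real.rpow_le_rpow hs hst (sub_nonneg.2 hα1))
  calc ‖x t‖ ^ 2 * (t ^ (1 - α) - s ^ (1 - α))
      ≤ H ^ 2 * t ^ (2 * γ - α + α) * (t ^ (1 - α) - s ^ (1 - α)) := by
        rw [sub_add_cancel]
        gcongr
    _ = H ^ 2 * t ^ (2 * γ - α) * (t ^ α * (t ^ (1 - α) - s ^ (1 - α))) := by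
        rw [Real.rpow_add_of_nonneg ht (sub_nonneg.2 hγ) hα0]
        ring
    _ ≤ H ^ 2 * T ^ (2 * γ - α) * (t - s) := by
        have hT : 0 ≤ T := ht.trans htT
        gcongr
        exact rpow_mul_rpow_sub_rpow_le hα0 hs hst

lemma intervalIntegrable_rlKernel_smul_norm_sub_sq (hα : α < 1) (hs : 0 ≤ s)
    (hx : ContinuousOn x (Icc 0 s)) (v : E) :
    IntervalIntegrable (fun τ => (1 / (s - τ) ^ α) • (‖x τ - v‖ ^ 2)) volume 0 s :=
  intervalIntegrable_rlKernel_smul_of_continuousOn hα hs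
    ((hx.sub continuousOn_const).norm.pow 2)

lemma norm_rlKernelIntegral_norm_sub_sq_sub_le (hα0 : 0 ≤ α) (hα1 : α < 1) (hγ : α < 2 * γ)
    (hγ1 : 2 * (γ : ℝ) ≤ 1) (hx : HolderOnWith H γ x (Icc 0 t)) (hs : 0 ≤ s) (hst : s ≤ t) :
    ‖rlKernelIntegral α (fun τ => ‖x τ - x t‖ ^ 2) t -
      rlKernelIntegral α (fun τ => ‖x τ - x t‖ ^ 2) s‖ ≤
        2 * H ^ 2 * t ^ (2 * γ - α) / (2 * γ - α) * (t - s) := by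
  have hγ0 : 0 < γ := by exact_mod_cast (by linarith : (0 : ℝ) < γ)
  have ht : 0 ≤ t := hs.trans hst
  have hxt := hx.continuousOn hγ0
  refine norm_rlKernelIntegral_sub_le_of_le_rpow hα0 hγ hγ1 hs hst (sq_nonneg (H : ℝ))
    (.of_forall fun τ hτ => ?_)
    (intervalIntegrable_rlKernel_smul_norm_sub_sq hα1 ht hxt _)
    (intervalIntegrable_rlKernel_smul_norm_sub_sq hα1 hs
      (hxt.mono (Icc_subset_Icc_right hst)) _)
  rw [norm_pow, norm_norm]
  exact norm_sub_sq_le_of_holderOnWith hx ⟨hτ.1.le, hτ.2⟩ (right_mem_Icc.2 ht) hτ.2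

variable [InnerProductSpace ℝ E] [CompleteSpace E]

lemma rlKernelIntegral_norm_sq (hα : α < 1) (hs : 0 ≤ s) (hx : ContinuousOn x (Icc 0 s)) (v : E) :
    rlKernelIntegral α (fun τ => ‖x τ‖ ^ 2) s = -(‖v‖ ^ 2 * (s ^ (1 - α) / (1 - α))) +
      2 * inner ℝ v (rlKernelIntegral α x s) + rlKernelIntegral α (fun τ => ‖x τ - v‖ ^ 2) s := by
  have hkernel := (intervalIntegrable_rlKernel hα hs le_rfl).const_mul (-‖v‖ ^ 2)
  have hkernelx := intervalIntegrable_rlKernel_smul_of_continuousOn hα hs hx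
  have hinner : IntervalIntegrable
      (fun τ => 2 * innerSL ℝ v ((1 / (s - τ) ^ α) • x τ)) volume 0 s :=
    ⟨((innerSL ℝ v).integrable_comp hkernelx.1).const_mul 2,
      ((innerSL ℝ v).integrable_comp hkernelx.2).const_mul 2⟩
  have hremainder := intervalIntegrable_rlKernel_smul_norm_sub_sq hα hs hx v
  calc rlKernelIntegral α (fun τ => ‖x τ‖ ^ 2) s
      = ∫ τ in (0 : ℝ)..s, (-‖v‖ ^ 2 * (1 / (s - τ) ^ α) +
          2 * innerSL ℝ v ((1 / (s - τ) ^ α) • x τ) + (1 / (s - τ) ^ α) • (‖x τ - v‖ ^ 2)) := by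
        refine intervalIntegral.integral_congr fun τ _ => ?_
        simp only [innerSL_apply_apply, inner_smul_right, smul_eq_mul, norm_sub_sq_real,
          real_inner_comm v]
        ring
    _ = _ := by
        rw [intervalIntegral.integral_add (hkernel.add hinner) hremainder,
          intervalIntegral.integral_add hkernel hinner, intervalIntegral.integral_const_mul,
          intervalIntegral.integral_const_mul, integral_rlKernel_self hα hs, sub_zero,
          (innerSL ℝ v).intervalIntegral_comp_comm hkernelx, neg_mul]
        rfl

lemma rlKernelIntegral_norm_sq_sub (hα : α < 1) (hs : 0 ≤ s) (hst : s ≤ t)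
    (hx : ContinuousOn x (Icc 0 t)) (v : E) :
    rlKernelIntegral α (fun τ => ‖x τ‖ ^ 2) t - rlKernelIntegral α (fun τ => ‖x τ‖ ^ 2) s =
      -(‖v‖ ^ 2 * (t ^ (1 - α) - s ^ (1 - α)) / (1 - α)) +
        2 * inner ℝ v (rlKernelIntegral α x t - rlKernelIntegral α x s) +
        (rlKernelIntegral α (fun τ => ‖x τ - v‖ ^ 2) t -
          rlKernelIntegral α (fun τ => ‖x τ - v‖ ^ 2) s) := by
  rw [rlKernelIntegral_norm_sq hα (hs.trans hst) hx v,
    rlKernelIntegral_norm_sq hα hs (hx.mono (Icc_subset_Icc_right hst)) v, inner_sub_right]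
  ring

lemma exists_lipschitzOnWith_rlKernelIntegral_norm_sq (hα0 : 0 ≤ α) (hα1 : α < 1)
    (hγ : α < 2 * γ) (hγ1 : 2 * (γ : ℝ) ≤ 1) (hx : HolderOnWith H γ x (Icc 0 T)) (hx0 : x 0 = 0)
    {L : ℝ≥0} (hL : LipschitzOnWith L (rlKernelIntegral α x) (Icc 0 T)) :
    ∃ K, LipschitzOnWith K (rlKernelIntegral α fun τ => ‖x τ‖ ^ 2) (Icc 0 T) := by
  have hγ0 : 0 < γ := by exact_mod_cast (by linarith : (0 : ℝ) < γ)
  have hα1' : 0 < 1 - α := sub_pos.2 hα1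
  refine ⟨_, lipschitzOnWith_of_norm_sub_le (C := H ^ 2 * T ^ (2 * γ - α) / (1 - α) +
    2 * (H * T ^ (γ : ℝ) * L) + 2 * H ^ 2 * T ^ (2 * γ - α) / (2 * γ - α))
    fun s hs t ht hst => ?_⟩
  have hT : 0 ≤ T := ht.1.trans ht.2
  have hxt : ContinuousOn x (Icc 0 t) :=
    (hx.continuousOn hγ0).mono (Icc_subset_Icc_right ht.2)
  have hconst : ‖-(‖x t‖ ^ 2 * (t ^ (1 - α) - s ^ (1 - α)) / (1 - α))‖ ≤
      H ^ 2 * T ^ (2 * γ - α) / (1 - α) * (t - s) := by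
    have hmono : 0 ≤ t ^ (1 - α) - s ^ (1 - α) :=
      sub_nonneg.2 (Real.rpow_le_rpow hs.1 hst hα1'.le)
    rw [norm_neg, Real.norm_of_nonneg (by positivity), div_mul_eq_mul_div]
    exact div_le_div_of_nonneg_right
      (norm_sq_mul_rpow_sub_rpow_le hα0 hα1.le hγ.le hx hx0 hs.1 hst ht.2) hα1'.le
  have hinner : ‖2 * inner ℝ (x t) (rlKernelIntegral α x t - rlKernelIntegral α x s)‖ ≤
      2 * (H * T ^ (γ : ℝ) * L) * (t - s) := by
    have hincrement : ‖rlKernelIntegral α x t - rlKernelIntegral α x s‖ ≤ L * (t - s) := by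
      simpa using norm_sub_le_of_holderOnWith (holderOnWith_one.2 hL) hs ht hst
    rw [norm_mul, Real.norm_two, mul_assoc 2, mul_assoc _ (L : ℝ)]
    gcongr
    exact (norm_inner_le_norm _ _).trans (mul_le_mul (norm_le_mul_rpow_of_holderOnWith hx hx0 ht)
      hincrement (norm_nonneg _) (by positivity))
  have hremainder : ‖rlKernelIntegral α (fun τ => ‖x τ - x t‖ ^ 2) t -
      rlKernelIntegral α (fun τ => ‖x τ - x t‖ ^ 2) s‖ ≤
        2 * H ^ 2 * T ^ (2 * γ - α) / (2 * γ - α) * (t - s) := by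
    refine (norm_rlKernelIntegral_norm_sub_sq_sub_le hα0 hα1 hγ hγ1
      (hx.mono (Icc_subset_Icc_right ht.2)) hs.1 hst).trans ?_
    have : 0 ≤ t - s := sub_nonneg.2 hst
    have : 0 < 2 * γ - α := sub_pos.2 hγ
    gcongr
    exacts [ht.1, ht.2]
  rw [rlKernelIntegral_norm_sq_sub hα1 hs.1 hst hxt (x t), add_mul, add_mul]
  exact norm_add_le_of_le (norm_add_le_of_le hconst hinner) hremainder

lemma MemRLIntegralLinfty.norm_sq (hx : MemRLIntegralLinfty α T x) (hα : α ∈ Ioo 0 1)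
    (hT : 0 < T) : MemRLIntegralLinfty α T fun t => ‖x t‖ ^ 2 := by
  obtain ⟨H, hH⟩ := hx.exists_holderOnWith hα
  obtain ⟨L, hL⟩ := hx.exists_lipschitzOnWith_rlKernelIntegral hα
  have hdiam : ∀ s ∈ Icc 0 T, ∀ t ∈ Icc 0 T, edist s t ≤ (T.toNNReal : ENNReal) :=
    fun s hs t ht => by
      rw [edist_dist]
      exact ENNReal.ofReal_le_ofReal (by simpa using Real.dist_le_of_mem_Icc hs ht)
  have hγ : ((min α.toNNReal (1 / 2) : ℝ≥0) : ℝ) = min α (1 / 2) := by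
    rw [NNReal.coe_min, Real.coe_toNNReal α hα.1.le, NNReal.coe_div, NNReal.coe_one,
      NNReal.coe_ofNat]
  obtain ⟨K, hK⟩ := exists_lipschitzOnWith_rlKernelIntegral_norm_sq (γ := min α.toNNReal (1 / 2))
    hα.1.le hα.2 (by grind) (by grind) (hH.of_le hdiam (min_le_left _ _)) (hx.apply_zero hT.le) hL
  exact memRLIntegralLinfty_of_lipschitzOnWith hα hT ((hx.continuousOn hα).norm.pow 2) hK

lemma rlKernelIntegral_norm_sq_sub_le (hα0 : 0 ≤ α) (hα1 : α < 1) (hγ : α < 2 * γ)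
    (hx : HolderOnWith H γ x (Icc 0 t)) (hs : 0 ≤ s) (hst : s ≤ t) :
    rlKernelIntegral α (fun τ => ‖x τ‖ ^ 2) t - rlKernelIntegral α (fun τ => ‖x τ‖ ^ 2) s ≤
      2 * inner ℝ (x t) (rlKernelIntegral α x t - rlKernelIntegral α x s) +
        H ^ 2 / (1 + (2 * γ - α)) * (t - s) ^ (1 + (2 * γ - α)) := by
  have hγ0 : 0 < γ := by exact_mod_cast (by linarith : (0 : ℝ) < γ)
  have ht : 0 ≤ t := hs.trans hst
  have hxt := hx.continuousOn hγ0
  have hconst : 0 ≤ ‖x t‖ ^ 2 * (t ^ (1 - α) - s ^ (1 - α)) / (1 - α) := by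
    have hα1' : 0 ≤ 1 - α := sub_nonneg.2 hα1.le
    have hmono := sub_nonneg.2 (Real.rpow_le_rpow hs hst hα1')
    positivity
  have hnear := (Real.le_norm_self _).trans (norm_integral_rlKernel_smul_le_of_le_rpow (c := α)
    (f := fun τ => ‖x τ - x t‖ ^ 2) (C := H ^ 2) (β := 2 * γ) (by linarith) hst
    (.of_forall fun τ hτ => by
      rw [norm_pow, norm_norm]
      exact norm_sub_sq_le_of_holderOnWith hx ⟨hs.trans hτ.1.le, hτ.2⟩ (right_mem_Icc.2 ht) hτ.2))
  have hfar : 0 ≤ ∫ τ in (0 : ℝ)..s,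
      (1 / (s - τ) ^ α - 1 / (t - τ) ^ α) • (‖x τ - x t‖ ^ 2) := by
    refine intervalIntegral.integral_nonneg_of_ae_restrict hs ?_
    filter_upwards [ae_restrict_mem measurableSet_Icc, ae_restrict_of_ae (volume.ae_ne s)]
      with τ hτ hτs
    have hle := sub_nonneg.2 (rlKernel_le_rlKernel hα0 (hτ.2.lt_of_ne hτs) hst)
    exact smul_nonneg hle (sq_nonneg _)
  rw [rlKernelIntegral_norm_sq_sub hα1 hs hst hxt (x t), rlKernelIntegral_sub hs hst
    (intervalIntegrable_rlKernel_smul_norm_sub_sq hα1 ht hxt _)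
    (intervalIntegrable_rlKernel_smul_norm_sub_sq hα1 hs (hxt.mono (Icc_subset_Icc_right hst)) _),
    div_mul_eq_mul_div]
  rw [← mul_div_assoc] at hnear
  linarith

end NormSq

section Derivative

lemma nonpos_of_hasDerivWithinAt_of_sub_le_rpow {h : ℝ → ℝ} {h' t C p : ℝ} (hp : 1 < p)
    (hh : HasDerivWithinAt h h' (Iio t) t)
    (hle : ∀ᶠ s in nhdsWithin t (Iio t), h t - h s ≤ C * (t - s) ^ p) : h' ≤ 0 := by
  rw [hasDerivWithinAt_iff_tendsto_slope' self_notMem_Iio] at hh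
  have hlim : Filter.Tendsto (fun s => C * (t - s) ^ (p - 1)) (nhdsWithin t (Iio t)) (nhds 0) := by
    have hcont : ContinuousAt (fun s => C * (t - s) ^ (p - 1)) t :=
      continuousAt_const.mul ((by fun_prop : ContinuousAt (fun s => t - s) t).rpow_const
        (Or.inr (sub_nonneg.2 hp.le)))
    simpa [ContinuousAt, Real.zero_rpow (sub_pos.2 hp).ne'] using
      hcont.mono_left nhdsWithin_le_nhds
  refine le_of_tendsto_of_tendsto hh hlim ?_
  filter_upwards [hle, self_mem_nhdsWithin] with s hs hst
  have hts : 0 < t - s := sub_pos.2 hst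
  rwa [slope_comm, slope_def_field, div_le_iff₀ hts, mul_assoc, ← Real.rpow_add_one hts.ne',
    sub_add_cancel]

variable {E : Type*} [NormedAddCommGroup E] {α t T : ℝ}

lemma rlDerivative_congr [NormedSpace ℝ E] {x y : ℝ → E} (hxy : EqOn x y (Icc 0 T))
    (ht : t ∈ Icc 0 T) : rlDerivative α T x t = rlDerivative α T y t := by
  have hkernel : EqOn (rlKernelIntegral α x) (rlKernelIntegral α y) (Icc 0 T) := fun s hs =>
    rlKernelIntegral_congr hs.1 (hxy.mono (Icc_subset_Icc_right hs.2))
  rw [rlDerivative, rlDerivative, derivWithin_congr hkernel (hkernel ht)]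

lemma rlDerivative_norm_sq_le [InnerProductSpace ℝ E] [CompleteSpace E] {H γ : ℝ≥0} {x : ℝ → E}
    (hα0 : 0 ≤ α) (hα1 : α < 1) (hγ : α < 2 * γ) (hx : HolderOnWith H γ x (Icc 0 T))
    (ht : t ∈ Ioc 0 T) (hDx : HasRLDerivative α T x t)
    (hDy : HasRLDerivative α T (fun τ => ‖x τ‖ ^ 2) t) :
    rlDerivative α T (fun τ => ‖x τ‖ ^ 2) t ≤ 2 * inner ℝ (x t) (rlDerivative α T x t) := by
  have := Real.Gamma_pos_of_pos (sub_pos.2 hα1)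
  have hdiff : HasDerivWithinAt (fun s => rlKernelIntegral α (fun τ => ‖x τ‖ ^ 2) s -
      2 * innerSL ℝ (x t) (rlKernelIntegral α x s)) _ (Iio t) t :=
    (hDy.2.hasDerivWithinAt.sub (((innerSL ℝ (x t)).hasFDerivAt.comp_hasDerivWithinAt t
      hDx.2.hasDerivWithinAt).const_mul 2)).mono_of_mem_nhdsWithin (Icc_mem_nhdsLT_of_mem ht)
  have hnonpos := nonpos_of_hasDerivWithinAt_of_sub_le_rpow (by linarith) hdiff
    (C := H ^ 2 / (1 + (2 * γ - α))) (p := 1 + (2 * γ - α)) (by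
      filter_upwards [Ioo_mem_nhdsLT ht.1] with s hs
      have hle := rlKernelIntegral_norm_sq_sub_le hα0 hα1 hγ
        (hx.mono (Icc_subset_Icc_right ht.2)) hs.1.le hs.2.le
      rw [inner_sub_right] at hle
      simp only [innerSL_apply_apply]
      linarith)
  rw [innerSL_apply_apply, sub_nonpos] at hnonpos
  rw [rlDerivative, rlDerivative, inner_smul_right, smul_eq_mul, mul_left_comm]
  gcongr

end Derivative

end FractionalCalculus

open FractionalCalculus in
theorem mainTheorem5_general {E : Type*} [NormedAddCommGroup E] [InnerProductSpace ℝ E]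
    [CompleteSpace E] {α T : ℝ} (hα : α ∈ Ioo 0 1) (hT : 0 < T) {x : ℝ → E}
    (hx : MemRLIntegralLinfty α T x) {y : ℝ → ℝ} (hy : ∀ t ∈ Icc 0 T, y t = ‖x t‖ ^ 2) :
    MemRLIntegralLinfty α T y ∧
      ∀ᵐ t ∂(volume.restrict (Icc 0 T)),
        HasRLDerivative α T x t ∧ HasRLDerivative α T y t ∧
          rlDerivative α T y t ≤ 2 * inner ℝ (x t) (rlDerivative α T x t) := by
  have hsq := hx.norm_sq hα hT
  have hyclass : MemRLIntegralLinfty α T y := hsq.congr fun t ht => (hy t ht).symm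
  obtain ⟨H, hH⟩ := hx.exists_holderOnWith hα
  refine ⟨hyclass, ?_⟩
  filter_upwards [hx.ae_hasRLDerivative hα hT.le, hyclass.ae_hasRLDerivative hα hT.le,
    hsq.ae_hasRLDerivative hα hT.le, ae_restrict_mem measurableSet_Icc,
    ae_restrict_of_ae (volume.ae_ne 0)] with t hDx hDy hDsq ht ht0
  refine ⟨hDx, hDy, ?_⟩
  rw [rlDerivative_congr hy ht]
  refine rlDerivative_norm_sq_le hα.1.le hα.2 ?_ hH ⟨ht.1.lt_of_ne' ht0, ht.2⟩ hDx hDsq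
  rw [Real.coe_toNNReal α hα.1.le]
  linarith [hα.1]

theorem mainTheorem5 (n : ℕ) (α T : ℝ) (hα : α ∈ Set.Ioo (0 : ℝ) 1) (hT : 0 < T)
    (x : ℝ → EuclideanSpace ℝ (Fin n))
    (hx : FractionalCalculus.MemRLIntegralLinfty α T x)
    (y : ℝ → ℝ) (hy : ∀ t ∈ Set.Icc 0 T, y t = ‖x t‖ ^ 2) :
    FractionalCalculus.MemRLIntegralLinfty α T y ∧
      ∀ᵐ t ∂(MeasureTheory.volume.restrict (Set.Icc 0 T)),
        FractionalCalculus.HasRLDerivative α T x t ∧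
        FractionalCalculus.HasRLDerivative α T y t ∧
        FractionalCalculus.rlDerivative α T y t ≤
          2 * inner ℝ (x t) (FractionalCalculus.rlDerivative α T x t) :=
  mainTheorem5_general hα hT hx hy
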